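/- Let $\widehat{\mathbb Z}=\prod_\ell \mathbb Z_\ell$ (product over all primes $\ell$) be the ring of profinite integers and, for $N\ge 1$, let $\mathbb Z_N=\prod_{\ell\mid N}\mathbb Z_\ell$. The groups $\mathrm{GL}_2(\widehat{\mathbb Z})$ and $\mathrm{SL}_2(\widehat{\mathbb Z})$ carry their profinite topology. The level of an open subgroup $H$ of $\mathrm{GL}_2(\widehat{\mathbb Z})$ (respectively of $\mathrm{SL}_2(\widehat{\mathbb Z})$) is the smallest positive integer $n$ such that $H$ contains the kernel of the reduction map $\mathrm{GL}_2(\widehat{\mathbb Z})\to\mathrm{GL}_2(\mathbb Z/n\mathbb Z)$ (respectively $\mathrm{SL}_2(\widehat{\mathbb Z})\to\mathrm{SL}_2(\mathbb Z/n\mathbb Z)$). For an open subgroup $H$ of $\mathrm{GL}_2(\widehat{\mathbb Z})$, let $[H,H]$ be the closed subgroup of $\mathrm{GL}_2(\widehat{\mathbb Z})$ topologically generated by the commutators of elements of $H$. A subgroup $H$ of $\mathrm{GL}_2(\widehat{\mathbb Z})$ is called agreeable if it is open, satisfies $\det H=\widehat{\mathbb Z}^\times$, contains all scalar matrices $\widehat{\mathbb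 Z}^\times\cdot I$, and the level of $H$ in $\mathrm{GL}_2(\widehat{\mathbb Z})$ and the level of $H\cap\mathrm{SL}_2(\widehat{\mathbb Z})$ in $\mathrm{SL}_2(\widehat{\mathbb Z})$ have the same odd prime divisors. Let $G$ be an open subgroup of $\mathrm{GL}_2(\widehat{\mathbb Z})$ with $\det G=\widehat{\mathbb Z}^\times$. Then $[G,G]$ is an open subgroup of $\mathrm{SL}_2(\widehat{\mathbb Z})$. Let $N$ be the product of the primes that divide the level of $[G,G]$ in $\mathrm{SL}_2(\widehat{\mathbb Z})$, let $G_N$ be the image of $G$ in $\mathrm{GL}_2(\mathbb Z_N)$, and put $$\mathcal G:=(\mathbb Z_N^\times\cdot G_N)\times\prod_{\ell\nmid N}\mathrm{GL}_2(\mathbb Z_\ell)\subseteq \mathrm{GL}_2(\mathbb Z_N)\times\prod_{\ell\nmid N}\mathrm{GL}_2(\mathbb Z_\ell)=\mathrm{GL}_2(\widehat{\mathbb Z}).$$ Then: 1. With respect to inclusion there is a unique minimal agreeable subgroup of $\mathrm{GL}_2(\widehat{\mathbb Z})$ that contains $G$ (the agreeable closure of $G$). It is $\mathcal G$, and $\mathcal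 G$ is contained in every agreeable subgroup that contains $G$. 2. $[G,G]=[\mathcal G,\mathcal G]$. 3. $G$ is a normal subgroup of $\mathcal G$, and $\mathcal G/G$ is finite and abelian. -/

import Mathlib

open Matrix

noncomputable section

instance factPrimeOfPrimes (p : Nat.Primes) : Fact (p : ℕ).Prime := ⟨p.2⟩

/-- The ring of profinite integers `Ẑ = ∏_ℓ ℤ_ℓ`, with the product topology. -/
abbrev ZHat : Type := (p : Nat.Primes) → ℤ_[(p : ℕ)]

/-- The ring `ℤ_N = ∏_{ℓ ∣ N} ℤ_ℓ`. -/
abbrev ZAdic (N : ℕ) : Type := (p : {p : Nat.Primes // (p : ℕ) ∣ N}) → ℤ_[(p.1 : ℕ)]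

/-- The projection `Ẑ = ℤ_N × ∏_{ℓ ∤ N} ℤ_ℓ → ℤ_N`. -/
def ZHat.proj (N : ℕ) : ZHat →+* ZAdic N :=
  RingHom.pi fun p => Pi.evalRingHom (fun q : Nat.Primes => ℤ_[(q : ℕ)]) p.1

/-- Reduction modulo `n`, as a map from `Ẑ` to `Ẑ/nẐ = ℤ/nℤ`. -/
abbrev ZHat.red (n : ℕ) : ZHat →+* ZHat ⧸ Ideal.span {(n : ZHat)} :=
  Ideal.Quotient.mk (Ideal.span {(n : ZHat)})

/-- The group `Rˣ · I` of invertible scalar matrices in `GL₂(R)`. -/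
def scalarSubgroup (R : Type) [CommRing R] : Subgroup (GL (Fin 2) R) :=
  (Units.map (Matrix.scalar (Fin 2) : R →+* Matrix (Fin 2) (Fin 2) R).toMonoidHom).range

/-- The level of an open subgroup `H` of `GL₂(Ẑ)`: the smallest positive integer `n` such that `H`
contains the kernel of `GL₂(Ẑ) → GL₂(ℤ/nℤ)`. -/
def levelGL (H : Subgroup (GL (Fin 2) ZHat)) : ℕ :=
  sInf {n : ℕ | 0 < n ∧ (Matrix.GeneralLinearGroup.map (n := Fin 2) (ZHat.red n)).ker ≤ H}

/-- The level of an open subgroup `H` of `SL₂(Ẑ)`: the smallest positive integer `n` such that `H`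
contains the kernel of `SL₂(Ẑ) → SL₂(ℤ/nℤ)`. -/
def levelSL (H : Subgroup (Matrix.SpecialLinearGroup (Fin 2) ZHat)) : ℕ :=
  sInf {n : ℕ | 0 < n ∧ (Matrix.SpecialLinearGroup.map (n := Fin 2) (ZHat.red n)).ker ≤ H}

/-- `H ∩ SL₂(Ẑ)`, as a subgroup of `SL₂(Ẑ)`. -/
def interSL (H : Subgroup (GL (Fin 2) ZHat)) : Subgroup (Matrix.SpecialLinearGroup (Fin 2) ZHat) :=
  H.comap Matrix.SpecialLinearGroup.toGL

/-- The commutator subgroup `[H, H]` of a closed (for instance, open) subgroup `H` of `GL₂(Ẑ)` in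
the sense of topological groups: the smallest closed subgroup that contains all commutators of
elements of `H`. As `H` is closed, taking the closure in `GL₂(Ẑ)` is the same as taking it
in `H`. -/
def topCommutator (H : Subgroup (GL (Fin 2) ZHat)) : Subgroup (GL (Fin 2) ZHat) :=
  (⁅H, H⁆ : Subgroup (GL (Fin 2) ZHat)).topologicalClosure

/-- Agreeable subgroups of `GL₂(Ẑ)`: open, with full determinant, containing all scalar matrices,
and such that the levels of `H` in `GL₂(Ẑ)` and of `H ∩ SL₂(Ẑ)` in `SL₂(Ẑ)` have the same odd prime
divisors. -/
structure IsAgreeable (H : Subgroup (GL (Fin 2) ZHat)) : Prop where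
  isOpen : IsOpen (H : Set (GL (Fin 2) ZHat))
  map_det : H.map Matrix.GeneralLinearGroup.det = ⊤
  scalar_le : scalarSubgroup ZHat ≤ H
  level_iff : ∀ p : ℕ, p.Prime → p ≠ 2 → (p ∣ levelGL H ↔ p ∣ levelSL (interSL H))

/-- The product `N` of the primes that divide the level of `[G, G]` in `SL₂(Ẑ)`. -/
def commutatorRadical (G : Subgroup (GL (Fin 2) ZHat)) : ℕ :=
  ∏ p ∈ (levelSL (interSL (topCommutator G))).primeFactors, p

/-- The image `G_N` of `G` in `GL₂(ℤ_N)`. -/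
def imageAdic (N : ℕ) (G : Subgroup (GL (Fin 2) ZHat)) : Subgroup (GL (Fin 2) (ZAdic N)) :=
  G.map (Matrix.GeneralLinearGroup.map (ZHat.proj N))

/-- The subgroup `(ℤ_Nˣ · G_N) × ∏_{ℓ ∤ N} GL₂(ℤ_ℓ)` of
`GL₂(Ẑ) = GL₂(ℤ_N) × ∏_{ℓ ∤ N} GL₂(ℤ_ℓ)`, where `N` is the product of the primes that divide the
level of `[G, G]`: it is the preimage of `ℤ_Nˣ · G_N` under the projection to `GL₂(ℤ_N)`. The
scalars are central, so that the join of the two subgroups is their product. -/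
def agreeableClosure (G : Subgroup (GL (Fin 2) ZHat)) : Subgroup (GL (Fin 2) ZHat) :=
  (scalarSubgroup (ZAdic (commutatorRadical G)) ⊔ imageAdic (commutatorRadical G) G).comap
    (Matrix.GeneralLinearGroup.map (ZHat.proj (commutatorRadical G)))

end

/-!
Everything is done through the decomposition `GL₂(Ẑ) = ∏_ℓ GL₂(ℤ_ℓ)`. For an open subgroup `H`, a
prime does not divide the level of `H` if and only if `H` contains the whole factor at that prime
(`ZHat.not_dvd_levelOn_iff`), and then `H` contains every element that is trivial at the primes
dividing its level (`ZHat.mem_of_forall_dvd_levelOn`). The same holds in `SL₂(Ẑ)`.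

That `[G, G]` is open in `SL₂(Ẑ)` comes from elementary matrices: `G` contains a principal congruence
subgroup of some even level `n`, the commutators of that group with the matrices `diag(u, 1)`, where
`u - 1` is `n` times a unit of `Ẑ`, yield all elementary matrices with off-diagonal entries in
`n²Ẑ`, and products of five of these yield all matrices in `SL₂(Ẑ)` that are congruent to `1`
modulo `n⁴` (`ZHat.ker_det_inf_gamma_le_commutator`).

Write `𝒢` for the explicit group. By the definition of `N`, the group `[G, G]` contains all elements
of `SL₂(Ẑ)` that are trivial at the primes dividing `N`. An element of `𝒢` agrees at these primes
with an element of `Ẑˣ · G`. Hence a commutator in `𝒢` agrees there with a commutator in `G`, and the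
two differ by an element of `[G, G]`. So `[𝒢, 𝒢] = [G, G] ⊆ G`
(`ZHat.commutator_agreeableClosure_le`), which makes `G` normal in `𝒢` with abelian quotient; the
quotient is finite because `G` is open in the compact group `GL₂(Ẑ)`.

If `SL₂(ℤ_p) ⊆ 𝒢` for an odd prime `p`, then commutators with an element of `𝒢` whose `p`-component
is `diag(2, 1)` show that `SL₂(ℤ_p) ⊆ [𝒢, 𝒢] = [G, G]` (`ZHat.mem_commutator_of_forall_mem`), so
that `p ∤ N` and `GL₂(ℤ_p) ⊆ 𝒢`. This makes `𝒢` agreeable. Conversely, `N` is even, as the sign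
character of `GL₂(𝔽₂) ≃ S₃` shows (`ZHat.two_dvd_commutatorRadical`). If `H` is agreeable and contains
`G`, then for a prime `ℓ ∤ N`, which is odd, `H` contains `SL₂(ℤ_ℓ) ⊆ [G, G]` and therefore
`GL₂(ℤ_ℓ)`. As `H` also contains `Ẑˣ · G`, it contains `𝒢` (`ZHat.agreeableClosure_le`).
-/

noncomputable section

/-! ### Components and levels -/

namespace ZHat

/-- The decomposition `GL₂(Ẑ) = ∏_ℓ GL₂(ℤ_ℓ)`. -/
def glEquiv : GL (Fin 2) ZHat ≃* ((p : Nat.Primes) → GL (Fin 2) ℤ_[(p : ℕ)]) :=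
  (Units.mapEquiv Matrix.piRingEquiv.toMulEquiv).trans MulEquiv.piUnits

@[simp]
lemma glEquiv_apply (g : GL (Fin 2) ZHat) (p : Nat.Primes) (i j : Fin 2) :
    (glEquiv g p).val i j = g.val i j p := rfl

lemma glEquiv_eq_map (g : GL (Fin 2) ZHat) (p : Nat.Primes) :
    glEquiv g p = Matrix.GeneralLinearGroup.map (Pi.evalRingHom _ p) g := rfl

lemma det_glEquiv (g : GL (Fin 2) ZHat) (p : Nat.Primes) :
    (Matrix.GeneralLinearGroup.det (glEquiv g p)).val =
      (Matrix.GeneralLinearGroup.det g).val p := by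
  rw [glEquiv_eq_map, Matrix.GeneralLinearGroup.map_det]
  rfl

lemma det_eq_one_iff {g : GL (Fin 2) ZHat} :
    Matrix.GeneralLinearGroup.det g = 1 ↔
      ∀ p, Matrix.GeneralLinearGroup.det (glEquiv g p) = 1 := by
  simp only [Units.ext_iff, det_glEquiv, Units.val_one]
  exact funext_iff

lemma gl_ext {g h : GL (Fin 2) ZHat} (H : ∀ p, glEquiv g p = glEquiv h p) : g = h :=
  glEquiv.injective (funext H)

open Classical in
/-- The endomorphism of `GL₂(Ẑ) = ∏_ℓ GL₂(ℤ_ℓ)` that keeps the components in `P` and replaces the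
others by `1`. -/
def restrict (P : Set Nat.Primes) : GL (Fin 2) ZHat →* GL (Fin 2) ZHat :=
  (glEquiv.symm.toMonoidHom.comp
    (MonoidHom.pi fun p => if p ∈ P then Pi.evalMonoidHom _ p else 1)).comp glEquiv.toMonoidHom

lemma glEquiv_restrict_of_mem {P : Set Nat.Primes} {p : Nat.Primes} (hp : p ∈ P)
    (g : GL (Fin 2) ZHat) : glEquiv (restrict P g) p = glEquiv g p := by
  simp [restrict, hp]

lemma glEquiv_restrict_of_notMem {P : Set Nat.Primes} {p : Nat.Primes} (hp : p ∉ P)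
    (g : GL (Fin 2) ZHat) : glEquiv (restrict P g) p = 1 := by
  simp [restrict, hp]

lemma restrict_mul_restrict_compl (P : Set Nat.Primes) (g : GL (Fin 2) ZHat) :
    restrict P g * restrict Pᶜ g = g := by
  refine gl_ext fun p => ?_
  by_cases hp : p ∈ P
  · simp [glEquiv_restrict_of_mem hp, glEquiv_restrict_of_notMem (P := Pᶜ) (by simpa using hp)]
  · simp [glEquiv_restrict_of_notMem hp, glEquiv_restrict_of_mem (P := Pᶜ) hp]

/-- The principal congruence subgroup of `GL₂(Ẑ)` of level `n`. -/
abbrev gamma (n : ℕ) : Subgroup (GL (Fin 2) ZHat) :=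
  (Matrix.GeneralLinearGroup.map (n := Fin 2) (ZHat.red n)).ker

lemma natCast_dvd_iff {n : ℕ} {x : ZHat} : (n : ZHat) ∣ x ↔
    ∀ p : Nat.Primes, (n : ℤ_[(p : ℕ)]) ∣ x p :=
  pi_dvd_iff

lemma mem_gamma_iff_dvd {n : ℕ} {g : GL (Fin 2) ZHat} :
    g ∈ gamma n ↔ ∀ i j, (n : ZHat) ∣ g.val i j - (1 : Matrix (Fin 2) (Fin 2) ZHat) i j := by
  rw [MonoidHom.mem_ker, Matrix.GeneralLinearGroup.ext_iff]
  refine forall₂_congr fun i j => ?_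
  rw [← Ideal.mem_span_singleton, ← Ideal.Quotient.eq, Matrix.GeneralLinearGroup.map_apply]
  obtain rfl | hij := eq_or_ne i j
  · rw [Units.val_one, Matrix.one_apply_eq, Matrix.one_apply_eq, map_one]
  · rw [Units.val_one, Matrix.one_apply_ne hij, Matrix.one_apply_ne hij, map_zero]

lemma mem_gamma_iff {n : ℕ} {g : GL (Fin 2) ZHat} :
    g ∈ gamma n ↔ ∀ (p : Nat.Primes) (i j : Fin 2), (n : ℤ_[(p : ℕ)]) ∣
      (glEquiv g p).val i j - (1 : Matrix (Fin 2) (Fin 2) ℤ_[(p : ℕ)]) i j := by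
  simp only [mem_gamma_iff_dvd, natCast_dvd_iff]
  have key (p : Nat.Primes) (i j : Fin 2) : (1 : Matrix (Fin 2) (Fin 2) ZHat) i j p =
      (1 : Matrix (Fin 2) (Fin 2) ℤ_[(p : ℕ)]) i j := by
    obtain rfl | hij := eq_or_ne i j
    · rw [Matrix.one_apply_eq, Matrix.one_apply_eq, Pi.one_apply]
    · rw [Matrix.one_apply_ne hij, Matrix.one_apply_ne hij, Pi.zero_apply]
  exact ⟨fun h p i j => by simpa [key] using h i j p, fun h i j p => by simpa [key] using h p i j⟩

lemma isUnit_natCast {p : Nat.Primes} {n : ℕ} (h : ¬ (p : ℕ) ∣ n) :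
    IsUnit (n : ℤ_[(p : ℕ)]) := by
  by_contra h'
  rw [PadicInt.not_isUnit_iff] at h'
  have := (PadicInt.norm_int_lt_one_iff_dvd (p := p) (n : ℤ)).1 (by simpa using h')
  exact h (by exact_mod_cast this)

lemma gamma_le_gamma {m n : ℕ} (h : m ∣ n) : gamma n ≤ gamma m := fun _ hg =>
  mem_gamma_iff_dvd.2 fun i j => (Nat.cast_dvd_cast h).trans (mem_gamma_iff_dvd.1 hg i j)

lemma mem_gamma_of_forall_eq_one {n : ℕ} {g : GL (Fin 2) ZHat}
    (h : ∀ p : Nat.Primes, (p : ℕ) ∣ n → glEquiv g p = 1) : g ∈ gamma n := by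
  refine mem_gamma_iff.2 fun p i j => ?_
  by_cases hp : (p : ℕ) ∣ n
  · simp [h p hp]
  · exact (isUnit_natCast hp).dvd

/-- The level of `H` relative to a subgroup `T` of `GL₂(Ẑ)`: the smallest positive integer `n` such
that `H` contains the elements of `T` that are congruent to `1` modulo `n`. The levels in `GL₂(Ẑ)`
and in `SL₂(Ẑ)` are the cases where `T` is everything and the kernel of the determinant. -/
def levelOn (T H : Subgroup (GL (Fin 2) ZHat)) : ℕ :=
  sInf {n : ℕ | 0 < n ∧ T ⊓ gamma n ≤ H}

lemma levelGL_eq (H : Subgroup (GL (Fin 2) ZHat)) : levelGL H = levelOn ⊤ H := by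
  simp [levelGL, levelOn]

lemma mem_ker_map_red_iff {n : ℕ} {A : SpecialLinearGroup (Fin 2) ZHat} :
    A ∈ (Matrix.SpecialLinearGroup.map (n := Fin 2) (ZHat.red n)).ker ↔
      SpecialLinearGroup.toGL A ∈ gamma n := by
  have h : SpecialLinearGroup.toGL (SpecialLinearGroup.map (ZHat.red n) A) =
      Matrix.GeneralLinearGroup.map (ZHat.red n) (SpecialLinearGroup.toGL A) := by
    ext i j
    rfl
  rw [MonoidHom.mem_ker, MonoidHom.mem_ker, ← h,
    map_eq_one_iff _ SpecialLinearGroup.toGL_injective]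

lemma exists_toGL_eq {g : GL (Fin 2) ZHat} (h : g ∈ Matrix.GeneralLinearGroup.det.ker) :
    ∃ A, SpecialLinearGroup.toGL A = g := by
  have : g ∈ Set.range (SpecialLinearGroup.toGL : SpecialLinearGroup (Fin 2) ZHat → _) := by
    rw [SpecialLinearGroup.range_toGL]
    exact h
  exact this

lemma ker_map_red_le_iff {n : ℕ} {H : Subgroup (GL (Fin 2) ZHat)} :
    (Matrix.SpecialLinearGroup.map (n := Fin 2) (ZHat.red n)).ker ≤ interSL H ↔
      Matrix.GeneralLinearGroup.det.ker ⊓ gamma n ≤ H := by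
  constructor
  · rintro h g ⟨hg, hn⟩
    obtain ⟨A, rfl⟩ := exists_toGL_eq hg
    exact h (mem_ker_map_red_iff.2 hn)
  · intro h A hA
    exact h ⟨by simp, mem_ker_map_red_iff.1 hA⟩

lemma levelSL_interSL_eq (H : Subgroup (GL (Fin 2) ZHat)) :
    levelSL (interSL H) = levelOn Matrix.GeneralLinearGroup.det.ker H := by
  simp only [levelSL, levelOn, ker_map_red_le_iff]

section level

variable {T H : Subgroup (GL (Fin 2) ZHat)}

lemma levelOn_mem (hH : ∃ n, 0 < n ∧ T ⊓ gamma n ≤ H) :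
    0 < levelOn T H ∧ T ⊓ gamma (levelOn T H) ≤ H := Nat.sInf_mem hH

/-- An element of `T` that is trivial at the primes dividing the level lies in `H`: at all other
primes, the level is a unit. -/
lemma mem_of_forall_dvd_levelOn (hH : ∃ n, 0 < n ∧ T ⊓ gamma n ≤ H) {g : GL (Fin 2) ZHat}
    (hgT : g ∈ T) (hg : ∀ p : Nat.Primes, (p : ℕ) ∣ levelOn T H → glEquiv g p = 1) : g ∈ H :=
  (levelOn_mem hH).2 ⟨hgT, mem_gamma_of_forall_eq_one hg⟩

/-- A prime does not divide the level of `H` if and only if `H` contains the factor of `T` at that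
prime. -/
lemma not_dvd_levelOn_iff (hT : ∀ (P : Set Nat.Primes), ∀ g ∈ T, restrict P g ∈ T)
    (hH : ∃ n, 0 < n ∧ T ⊓ gamma n ≤ H) (p : Nat.Primes) :
    ¬ (p : ℕ) ∣ levelOn T H ↔ ∀ g ∈ T, (∀ q, q ≠ p → glEquiv g q = 1) → g ∈ H := by
  constructor
  · intro hp g hgT hg
    exact mem_of_forall_dvd_levelOn hH hgT fun q hq => hg q fun h => hp (h ▸ hq)
  · intro h hp
    obtain ⟨hpos, hle⟩ := levelOn_mem hH
    obtain ⟨k, n, hn, hkn⟩ := Nat.exists_eq_pow_mul_and_not_dvd hpos.ne' p p.2.ne_one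
    have hn0 : 0 < n := Nat.pos_of_ne_zero fun h0 => hn (h0 ▸ dvd_zero _)
    -- the prime-to-`p` part of the level has the defining property of the level
    have hmem : 0 < n ∧ T ⊓ gamma n ≤ H := by
      refine ⟨hn0, fun g ⟨hgT, hgn⟩ => ?_⟩
      rw [← restrict_mul_restrict_compl {p} g]
      refine H.mul_mem (h _ (hT _ _ hgT) fun q hq => glEquiv_restrict_of_notMem (by simpa) _)
        (hle ⟨hT _ _ hgT, mem_gamma_iff.2 fun q i j => ?_⟩)
      by_cases hq : q = p
      · simp [glEquiv_restrict_of_notMem (P := {p}ᶜ) (p := q) (by simpa using hq)]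
      · rw [glEquiv_restrict_of_mem (by simpa using hq), hkn, Nat.cast_mul, Nat.cast_pow]
        have hu : IsUnit ((p : ℕ) : ℤ_[(q : ℕ)]) := isUnit_natCast fun hd =>
          hq (Subtype.ext ((Nat.prime_dvd_prime_iff_eq q.2 p.2).1 hd))
        exact (hu.pow k).mul_left_dvd.2 (mem_gamma_iff.1 hgn q i j)
    have hlt : levelOn T H ≤ n := Nat.sInf_le hmem
    exact hn (Nat.le_antisymm hlt (Nat.le_of_dvd hpos ⟨p ^ k, by rw [hkn, mul_comm]⟩) ▸ hp)

end level

lemma restrict_mem_ker_det (P : Set Nat.Primes) :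
    ∀ g ∈ (Matrix.GeneralLinearGroup.det (n := Fin 2) (R := ZHat)).ker,
      restrict P g ∈ (Matrix.GeneralLinearGroup.det (n := Fin 2) (R := ZHat)).ker := by
  intro g hg
  rw [MonoidHom.mem_ker, det_eq_one_iff] at hg ⊢
  intro p
  by_cases hp : p ∈ P
  · rw [glEquiv_restrict_of_mem hp, hg]
  · rw [glEquiv_restrict_of_notMem hp, map_one]

end ZHat

/-! ### Congruence subgroups are a neighbourhood basis of the identity -/

namespace ZHat

open Filter Topology

lemma _root_.PadicInt.isOpen_setOf_dvd {p : ℕ} [Fact p.Prime] {a : ℤ_[p]} (ha : a ≠ 0) :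
    IsOpen {x : ℤ_[p] | a ∣ x} := by
  refine Metric.isOpen_iff.2 fun x hx => ⟨‖a‖, norm_pos_iff.2 ha, fun y hy => ?_⟩
  have ha' : (a : ℚ_[p]) ≠ 0 := by simpa using ha
  have h : ‖((y - x : ℤ_[p]) : ℚ_[p]) / a‖ ≤ 1 := by
    rw [norm_div, div_le_one (norm_pos_iff.2 ha')]
    exact (mem_ball_iff_norm.1 hy).le
  have h' : a ∣ y - x := by
    refine ⟨⟨_, h⟩, PadicInt.ext ?_⟩
    have e : ((y - x : ℤ_[p]) : ℚ_[p]) = a * (((y - x : ℤ_[p]) : ℚ_[p]) / a) := by field_simp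
    exact e
  exact (dvd_sub_left hx).1 h'

lemma finite_setOf_dvd {n : ℕ} (hn : 0 < n) : {p : Nat.Primes | (p : ℕ) ∣ n}.Finite :=
  Set.Finite.of_finite_image ((Set.finite_Iic n).subset (by
    rintro _ ⟨p, hp, rfl⟩
    exact Nat.le_of_dvd hn hp)) (Subtype.val_injective.injOn)

lemma isOpen_setOf_natCast_dvd {n : ℕ} (hn : 0 < n) : IsOpen {x : ZHat | (n : ZHat) ∣ x} := by
  have h : {x : ZHat | (n : ZHat) ∣ x} = ⋂ p ∈ {p : Nat.Primes | (p : ℕ) ∣ n},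
      (fun x : ZHat => x p) ⁻¹' {x : ℤ_[(p : ℕ)] | (n : ℤ_[(p : ℕ)]) ∣ x} := by
    ext x
    simp only [Set.mem_ofPred_eq, natCast_dvd_iff, Set.mem_iInter, Set.mem_preimage]
    refine forall_congr' fun p => ⟨fun h _ => h, fun h => ?_⟩
    by_cases hp : (p : ℕ) ∣ n
    · exact h hp
    · exact (isUnit_natCast hp).dvd
  rw [h]
  exact (finite_setOf_dvd hn).isOpen_biInter fun p _ =>
    (PadicInt.isOpen_setOf_dvd (by exact_mod_cast hn.ne')).preimage (continuous_apply p)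

lemma isOpen_gamma {n : ℕ} (hn : 0 < n) : IsOpen (gamma n : Set (GL (Fin 2) ZHat)) := by
  have h : (gamma n : Set (GL (Fin 2) ZHat)) = ⋂ i, ⋂ j, (fun g : GL (Fin 2) ZHat =>
      g.val i j - (1 : Matrix (Fin 2) (Fin 2) ZHat) i j) ⁻¹' {x : ZHat | (n : ZHat) ∣ x} := by
    ext g
    simp only [SetLike.mem_coe, mem_gamma_iff_dvd, Set.mem_iInter, Set.mem_preimage,
      Set.mem_ofPred_eq]
  rw [h]
  refine isOpen_iInter_of_finite fun i => isOpen_iInter_of_finite fun j =>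
    (isOpen_setOf_natCast_dvd hn).preimage ?_
  exact ((Units.continuous_val.matrix_elem i j).sub continuous_const)

lemma tendsto_natCast_factorial :
    Tendsto (fun n : ℕ => (n.factorial : ZHat)) atTop (𝓝 0) := by
  refine tendsto_pi_nhds.2 fun p => Metric.tendsto_atTop.2 fun ε hε => ?_
  obtain ⟨k, hk⟩ := PadicInt.exists_pow_neg_lt (p := p) hε
  refine ⟨(p : ℕ) ^ k, fun n hn => lt_of_le_of_lt ?_ hk⟩
  have h : (((p : ℕ) : ℤ) ^ k) ∣ (n.factorial : ℤ) := by
    exact_mod_cast Nat.dvd_factorial (pow_pos p.2.pos k) hn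
  simpa using PadicInt.norm_int_le_pow_iff_dvd.2 h

/-- The principal congruence subgroups are a neighbourhood basis of `1` in `GL₂(Ẑ)`. As `n!` tends
to `0` in `Ẑ` and the space of matrices is compact, `1 + n! X` and `1 + n! Y` are eventually in any
given neighbourhoods of `1`, uniformly in the matrices `X` and `Y`. -/
lemma exists_gamma_le {H : Subgroup (GL (Fin 2) ZHat)}
    (hH : IsOpen (H : Set (GL (Fin 2) ZHat))) : ∃ n, 0 < n ∧ gamma n ≤ H := by
  obtain ⟨W, hW, hWH⟩ := (Units.isInducing_embedProduct
    (M := Matrix (Fin 2) (Fin 2) ZHat)).isOpen_iff.1 hH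
  have : CompactSpace (Matrix (Fin 2) (Fin 2) ZHat) :=
    inferInstanceAs (CompactSpace (Fin 2 → Fin 2 → ZHat))
  let f : ZHat × (Matrix (Fin 2) (Fin 2) ZHat × Matrix (Fin 2) (Fin 2) ZHat) →
      Matrix (Fin 2) (Fin 2) ZHat × (Matrix (Fin 2) (Fin 2) ZHat)ᵐᵒᵖ :=
    fun z => (1 + z.1 • z.2.1, MulOpposite.op (1 + z.1 • z.2.2))
  have hf : Continuous f := by fun_prop
  have h1 : (Units.embedProduct _ 1) ∈ W := by
    have : (1 : GL (Fin 2) ZHat) ∈ Units.embedProduct _ ⁻¹' W := hWH ▸ H.one_mem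
    exact this
  have hev : ∀ᶠ c in 𝓝 (0 : ZHat), ∀ y ∈ Set.univ, f (c, y) ∈ W := by
    refine isCompact_univ.eventually_forall_of_forall_eventually fun y _ => ?_
    refine hf.continuousAt.eventually_mem (hW.mem_nhds ?_)
    have : f (0, y) = Units.embedProduct _ 1 := by simp [f]
    rwa [this]
  obtain ⟨n, hn⟩ := (tendsto_natCast_factorial.eventually hev).exists
  refine ⟨n.factorial, n.factorial_pos, fun g hg => ?_⟩
  have key {g : GL (Fin 2) ZHat} (hg : g ∈ gamma n.factorial) :
      ∃ X : Matrix (Fin 2) (Fin 2) ZHat, g.val = 1 + (n.factorial : ZHat) • X := by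
    choose X hX using mem_gamma_iff_dvd.1 hg
    refine ⟨Matrix.of X, ?_⟩
    ext1 i j
    rw [Matrix.add_apply, Matrix.smul_apply, Matrix.of_apply, smul_eq_mul, ← hX]
    ring
  obtain ⟨X, hX⟩ := key hg
  obtain ⟨Y, hY⟩ := key (inv_mem hg)
  have : g ∈ Units.embedProduct _ ⁻¹' W := by
    have hXY := hn (X, Y) trivial
    rw [Set.mem_preimage, Units.embedProduct_apply, hX, hY]
    exact hXY
  rwa [hWH] at this

end ZHat

/-! ### Elementary matrices over local rings -/

namespace Matrix.GeneralLinearGroup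

section elementary

open scoped commutatorElement

variable {R : Type*} [CommRing R]

/-- The elementary matrix with the entry `x` below the diagonal, an element of `GL₂(R)`. -/
def lowerLeft (x : R) : GL (Fin 2) R :=
  ⟨!![1, 0; x, 1], !![1, 0; -x, 1], by simp [one_fin_two], by simp [one_fin_two]⟩

/-- The diagonal matrix with the entries `u` and `1`, an element of `GL₂(R)`. -/
def diagOne (u : Rˣ) : GL (Fin 2) R :=
  ⟨!![(u : R), 0; 0, 1], !![((u⁻¹ : Rˣ) : R), 0; 0, 1], by simp [one_fin_two],
    by simp [one_fin_two]⟩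

lemma val_lowerLeft (x : R) : (lowerLeft x).val = !![1, 0; x, 1] := rfl

lemma val_diagOne (u : Rˣ) : (diagOne u).val = !![(u : R), 0; 0, 1] := rfl

lemma val_upperRightHom (x : R) : (upperRightHom x).val = !![1, x; 0, 1] := rfl

lemma det_diagOne (u : Rˣ) : det (diagOne u) = u := by
  ext
  simp [val_diagOne]

lemma det_upperRightHom (x : R) : det (upperRightHom x) = 1 := by
  ext
  simp

lemma det_lowerLeft (x : R) : det (lowerLeft x) = 1 := by
  ext
  simp [val_lowerLeft]

lemma lowerLeft_zero : lowerLeft (0 : R) = 1 := by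
  refine Units.ext ?_
  rw [val_lowerLeft, Units.val_one, one_fin_two]

lemma commutator_diagOne_upperRightHom (u : Rˣ) (x : R) :
    ⁅diagOne u, upperRightHom x⁆ = upperRightHom (((u : R) - 1) * x) := by
  rw [commutatorElement_def, mul_inv_eq_iff_eq_mul, mul_inv_eq_iff_eq_mul]
  refine Units.ext ?_
  simp only [Units.val_mul, val_diagOne, val_upperRightHom, Matrix.mul_fin_two]
  congr! 2 <;> ring_nf

lemma commutator_lowerLeft_diagOne (u : Rˣ) (x : R) :
    ⁅lowerLeft ((u : R) * x), diagOne u⁆ = lowerLeft (((u : R) - 1) * x) := by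
  rw [commutatorElement_def, mul_inv_eq_iff_eq_mul, mul_inv_eq_iff_eq_mul]
  refine Units.ext ?_
  simp only [Units.val_mul, val_diagOne, val_lowerLeft, Matrix.mul_fin_two]
  congr! 2 <;> ring_nf

/-- Over a local ring, a matrix in `SL₂` that is congruent to `1` modulo `m²` is a product of five
elementary matrices with off-diagonal entries in `(m)`. The first factor makes the upper left entry
a unit, which is automatic unless `m` is a unit. -/
lemma exists_eq_prod_elementary [IsLocalRing R] {m : R} {A : GL (Fin 2) R} (hdet : det A = 1)
    (hA : ∀ i j, m ^ 2 ∣ A.val i j - (1 : Matrix (Fin 2) (Fin 2) R) i j) :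
    ∃ x₁ x₂ x₃ x₄ x₅ : R, A = upperRightHom (m * x₁) * lowerLeft (m * x₂) *
      upperRightHom (m * x₃) * lowerLeft (m * x₄) * upperRightHom (m * x₅) := by
  have hd : A.val 0 0 * A.val 1 1 - A.val 0 1 * A.val 1 0 = 1 := by
    have := congrArg Units.val hdet
    rwa [val_det_apply, Matrix.det_fin_two] at this
  obtain ⟨a, ha⟩ := hA 0 0
  obtain ⟨b, hb⟩ := hA 0 1
  obtain ⟨c, hc⟩ := hA 1 0
  have hA2 : A.val = !![A.val 0 0, A.val 0 1; A.val 1 0, A.val 1 1] := eta_fin_two _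
  generalize A.val 0 0 = α at *
  generalize A.val 0 1 = β at *
  generalize A.val 1 0 = γ at *
  generalize A.val 1 1 = δ at *
  simp only [Matrix.one_apply_eq, ne_eq, zero_ne_one, one_ne_zero, not_false_eq_true,
    Matrix.one_apply_ne, sub_zero] at ha hb hc
  obtain rfl : α = 1 + m ^ 2 * a := by linear_combination ha
  subst hb hc
  -- `x` makes the upper left entry of `upperRightHom (m * x) * A` a unit
  obtain ⟨x, u, hu⟩ : ∃ x : R, IsUnit (1 + m ^ 2 * a + m * x * (m ^ 2 * c)) := by
    by_cases hα : IsUnit (1 + m ^ 2 * a)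
    · exact ⟨0, by simpa using hα⟩
    have hm : IsUnit m := by
      by_contra hm
      refine hα (by_contra fun h => ?_)
      have h1 : IsUnit (1 + m ^ 2 * a + -(m ^ 2 * a)) := by simp
      rcases IsLocalRing.isUnit_or_isUnit_of_isUnit_add h1 with h2 | h2
      · exact h h2
      · rw [IsUnit.neg_iff] at h2
        exact hm (isUnit_of_mul_isUnit_left (x := m) (y := m * a) (by convert h2 using 1; ring))
    have hγ : IsUnit (m ^ 2 * c) := by
      have h1 : IsUnit ((1 + m ^ 2 * a) * δ + -(m ^ 2 * b * (m ^ 2 * c))) := by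
        rw [← sub_eq_add_neg, hd]
        exact isUnit_one
      rcases IsLocalRing.isUnit_or_isUnit_of_isUnit_add h1 with h2 | h2
      · exact absurd (isUnit_of_mul_isUnit_left h2) hα
      · rw [IsUnit.neg_iff] at h2
        exact isUnit_of_mul_isUnit_right h2
    obtain ⟨v, rfl⟩ := hm
    refine ⟨((v⁻¹ : Rˣ) : R), ?_⟩
    rw [Units.mul_inv, one_mul]
    by_contra h
    have h1 : IsUnit (1 + (v : R) ^ 2 * a + (v : R) ^ 2 * c + -(1 + (v : R) ^ 2 * a)) := by
      convert hγ using 1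
      ring
    rcases IsLocalRing.isUnit_or_isUnit_of_isUnit_add h1 with h2 | h2
    · exact h h2
    · exact hα (by rwa [IsUnit.neg_iff] at h2)
  -- the upper left entry `u` is `1 + m * (m * t)`
  set w : R := ((u⁻¹ : Rˣ) : R) with hw
  have huw : (1 + m ^ 2 * a + m * x * (m ^ 2 * c)) * w = 1 := by rw [← hu, hw, Units.mul_inv]
  refine ⟨-x, (m * c - (a + m * x * c)) * w, 1, a + m * x * c,
    (m * b + x * δ - 1) * w, Units.ext ?_⟩
  rw [hA2]
  simp only [Units.val_mul, val_lowerLeft, val_upperRightHom, Matrix.mul_fin_two]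
  -- the second and the last factor have the entries `s * w` and `z * w`
  set s : R := m ^ 2 * c - m * (a + m * x * c) with hs
  set z : R := m ^ 2 * b + m * x * δ - m with hz
  rw [EmbeddingLike.apply_eq_iff_eq]
  simp only [Matrix.vecCons_inj, and_true]
  refine ⟨⟨?_, ?_⟩, ?_, ?_⟩
  · linear_combination (m * x * s) * huw
  · linear_combination (-z + m * x * (s * z * w + (δ - 1))) * huw - m * x * w * hd
  · linear_combination (-s) * huw
  · linear_combination (-(s * z * w + (δ - 1))) * huw + w * hd

end elementary

end Matrix.GeneralLinearGroup

/-! ### Commutators and elementary matrices over the profinite integers -/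

namespace ZHat

open Matrix.GeneralLinearGroup
open scoped commutatorElement

lemma glEquiv_upperRightHom (x : ZHat) (p : Nat.Primes) :
    glEquiv (upperRightHom x) p = upperRightHom (x p) := by
  ext i j
  fin_cases i <;> fin_cases j <;> simp

lemma glEquiv_lowerLeft (x : ZHat) (p : Nat.Primes) :
    glEquiv (lowerLeft x) p = lowerLeft (x p) := by
  ext i j
  fin_cases i <;> fin_cases j <;> simp [val_lowerLeft]

lemma glEquiv_commutatorElement (g h : GL (Fin 2) ZHat) (p : Nat.Primes) :
    glEquiv ⁅g, h⁆ p = ⁅glEquiv g p, glEquiv h p⁆ :=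
  map_commutatorElement ((Pi.evalMonoidHom _ p).comp glEquiv.toMonoidHom) g h

/-- A subgroup that contains the elementary matrices with off-diagonal entries in `cẐ` contains all
matrices in `SL₂(Ẑ)` that are congruent to `1` modulo `c²`: the number of factors in
`exists_eq_prod_elementary` is the same in every component, so that the factorizations over the
`ℤ_ℓ` assemble to one over `Ẑ`. The components of `c` may be `0`. -/
lemma mem_of_elementary_mem {K : Subgroup (GL (Fin 2) ZHat)} {c : ZHat}
    (hu : ∀ x, upperRightHom (c * x) ∈ K) (hl : ∀ x, lowerLeft (c * x) ∈ K)
    {g : GL (Fin 2) ZHat} (hdet : g ∈ det.ker)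
    (hg : ∀ (p : Nat.Primes) (i j : Fin 2), c p ^ 2 ∣
      (glEquiv g p).val i j - (1 : Matrix (Fin 2) (Fin 2) ℤ_[(p : ℕ)]) i j) : g ∈ K := by
  choose x₁ x₂ x₃ x₄ x₅ hx using fun p =>
    exists_eq_prod_elementary (det_eq_one_iff.1 hdet p) (hg p)
  have key : g = upperRightHom (c * x₁) * lowerLeft (c * x₂) * upperRightHom (c * x₃) *
      lowerLeft (c * x₄) * upperRightHom (c * x₅) := gl_ext fun p => by
    simp only [map_mul, Pi.mul_apply, glEquiv_upperRightHom, glEquiv_lowerLeft]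
    exact hx p
  rw [key]
  exact mul_mem (mul_mem (mul_mem (mul_mem (hu _) (hl _)) (hu _)) (hl _)) (hu _)

/-- If `n` is even, there is a unit `u` of `Ẑ` such that `u - 1` is a unit multiple of `n`. -/
lemma exists_unit_sub_one_eq {n : ℕ} (hn : 2 ∣ n) :
    ∃ u v : ZHatˣ, (u : ZHat) - 1 = n * v := by
  have key (p : Nat.Primes) : ∃ u v : ℤ_[(p : ℕ)]ˣ, (u : ℤ_[(p : ℕ)]) - 1 = n * v := by
    -- `u = 1 + n` if `p ∣ n`, and `u = 2` otherwise, when `p` is odd because `n` is even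
    by_cases hp : (p : ℕ) ∣ n
    · have h : ¬ (p : ℕ) ∣ 1 + n := fun h =>
        p.2.one_lt.ne' (Nat.dvd_one.1 ((Nat.dvd_add_left hp).1 h))
      exact ⟨(isUnit_natCast h).unit, 1, by simp⟩
    · have h : ¬ (p : ℕ) ∣ 2 := fun h => hp (h.trans hn)
      refine ⟨(isUnit_natCast h).unit, (isUnit_natCast hp).unit⁻¹, ?_⟩
      rw [IsUnit.unit_spec, IsUnit.mul_val_inv]
      norm_num
  choose u v huv using key
  exact ⟨MulEquiv.piUnits.symm u, MulEquiv.piUnits.symm v, funext huv⟩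

/-- If `n` is even, the commutators of the principal congruence subgroup of level `n` generate a
subgroup that contains all matrices of `SL₂(Ẑ)` that are congruent to `1` modulo `n⁴`. -/
lemma ker_det_inf_gamma_le_commutator {n : ℕ} (hn : 2 ∣ n) :
    det.ker ⊓ gamma ((n ^ 2) ^ 2) ≤ ⁅gamma n, gamma n⁆ := by
  obtain ⟨u, v, huv⟩ := exists_unit_sub_one_eq hn
  have hd : diagOne u ∈ gamma n := by
    rw [mem_gamma_iff_dvd]
    intro i j
    fin_cases i <;> fin_cases j <;> simp [val_diagOne, huv]
  have hu (x : ZHat) : upperRightHom (n * x) ∈ gamma n := by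
    rw [mem_gamma_iff_dvd]
    intro i j
    fin_cases i <;> fin_cases j <;> simp
  have hl (x : ZHat) : lowerLeft (n * x) ∈ gamma n := by
    rw [mem_gamma_iff_dvd]
    intro i j
    fin_cases i <;> fin_cases j <;> simp [val_lowerLeft]
  have hv (x : ZHat) : ((u : ZHat) - 1) * (n * ((v⁻¹ : ZHatˣ) * x)) = ((n ^ 2 : ℕ) : ZHat) * x := by
    rw [huv]
    push_cast
    linear_combination (n : ZHat) ^ 2 * x * v.mul_inv
  rintro g ⟨hdet, hg⟩
  refine mem_of_elementary_mem (c := ((n ^ 2 : ℕ) : ZHat)) (fun x => ?_) (fun x => ?_) hdet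
    fun p i j => ?_
  · rw [← hv, ← commutator_diagOne_upperRightHom]
    exact Subgroup.commutator_mem_commutator hd (hu _)
  · rw [← hv, ← commutator_lowerLeft_diagOne]
    refine Subgroup.commutator_mem_commutator ?_ hd
    rw [mul_left_comm]
    exact hl _
  · have := mem_gamma_iff.1 hg p i j
    rwa [Nat.cast_pow] at this

/-- If `H` contains the factor `SL₂(ℤ_p)` of `SL₂(Ẑ)` for an odd prime `p`, and has full
determinant, then already its commutators generate this factor. -/
lemma mem_commutator_of_forall_mem {H : Subgroup (GL (Fin 2) ZHat)}
    (hdet : H.map Matrix.GeneralLinearGroup.det = ⊤) {p : Nat.Primes} (hp : (p : ℕ) ≠ 2)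
    (hH : ∀ g ∈ det.ker, (∀ q, q ≠ p → glEquiv g q = 1) → g ∈ H)
    {g : GL (Fin 2) ZHat} (hg : g ∈ det.ker) (hgp : ∀ q, q ≠ p → glEquiv g q = 1) :
    g ∈ ⁅H, H⁆ := by
  have hp2 : IsUnit (2 : ℤ_[(p : ℕ)]) := by
    have : ¬ (p : ℕ) ∣ 2 := fun h => hp ((Nat.prime_dvd_prime_iff_eq p.2 Nat.prime_two).1 h)
    exact_mod_cast isUnit_natCast this
  set u := hp2.unit
  have hu1 : (u : ℤ_[(p : ℕ)]) - 1 = 1 := by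
    rw [IsUnit.unit_spec]
    norm_num
  -- an element `d` of `H` with `p`-component `diag(2, 1)`
  obtain ⟨d, hdH, hdp⟩ : ∃ d ∈ H, glEquiv d p = diagOne u := by
    classical
    obtain ⟨h, hhH, hh⟩ : MulEquiv.piUnits.symm (Pi.mulSingle p u) ∈
        H.map Matrix.GeneralLinearGroup.det := hdet ▸ Subgroup.mem_top _
    set k : GL (Fin 2) ZHat := glEquiv.symm (Pi.mulSingle p ((glEquiv h p)⁻¹ * diagOne u)) with hk
    have hhp : det (glEquiv h p) = u := by
      refine Units.ext ?_
      rw [det_glEquiv, hh, MulEquiv.val_piUnits_symm_apply, Pi.mulSingle_eq_same]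
    have hkp : glEquiv k p = (glEquiv h p)⁻¹ * diagOne u := by
      rw [hk, MulEquiv.apply_symm_apply, Pi.mulSingle_eq_same]
    have hkq (q : Nat.Primes) (hq : q ≠ p) : glEquiv k q = 1 := by
      rw [hk, MulEquiv.apply_symm_apply, Pi.mulSingle_eq_of_ne hq]
    refine ⟨h * k, mul_mem hhH (hH _ (det_eq_one_iff.2 fun q => ?_) hkq), ?_⟩
    · by_cases hq : q = p
      · subst hq
        rw [hkp, map_mul, map_inv, hhp, det_diagOne, inv_mul_cancel]
      · rw [hkq q hq, map_one]
    · rw [map_mul, Pi.mul_apply, hkp, mul_inv_cancel_left]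
  -- commutators with `d` reproduce the elementary matrices supported at `p`, as `2 - 1 = 1`
  classical
  set c : ZHat := Pi.single p 1 with hc
  have hcp : c p = 1 := Pi.single_eq_same _ _
  have hcq (q : Nat.Primes) (hq : q ≠ p) : c q = 0 := Pi.single_eq_of_ne hq _
  have huH (x : ZHat) : upperRightHom (c * x) ∈ H := by
    refine hH _ (det_upperRightHom _) fun q hq => ?_
    rw [glEquiv_upperRightHom, Pi.mul_apply, hcq q hq, zero_mul, AddChar.map_zero_eq_one]
  have hlH (x : ZHat) : lowerLeft (c * x) ∈ H := by
    refine hH _ (det_lowerLeft _) fun q hq => ?_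
    rw [glEquiv_lowerLeft, Pi.mul_apply, hcq q hq, zero_mul, lowerLeft_zero]
  refine mem_of_elementary_mem (c := c) (fun x => ?_) (fun x => ?_) hg fun q i j => ?_
  · have h : ⁅d, upperRightHom (c * x)⁆ = upperRightHom (c * x) := gl_ext fun q => by
      rw [glEquiv_commutatorElement, glEquiv_upperRightHom]
      by_cases hq : q = p
      · subst hq
        rw [hdp, commutator_diagOne_upperRightHom, hu1, one_mul]
      · rw [Pi.mul_apply, hcq q hq, zero_mul, AddChar.map_zero_eq_one, commutatorElement_one_right]
    rw [← h]
    exact Subgroup.commutator_mem_commutator hdH (huH x)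
  · have h : ⁅lowerLeft (c * (2 * x)), d⁆ = lowerLeft (c * x) := gl_ext fun q => by
      rw [glEquiv_commutatorElement, glEquiv_lowerLeft, glEquiv_lowerLeft]
      by_cases hq : q = p
      · subst hq
        have h2 : (c * (2 * x)) q = u * x q := by
          rw [Pi.mul_apply, hcp, one_mul]
          rfl
        rw [hdp, h2, commutator_lowerLeft_diagOne, hu1, Pi.mul_apply, hcp]
      · rw [Pi.mul_apply, Pi.mul_apply c x, hcq q hq, zero_mul, zero_mul, lowerLeft_zero,
          commutatorElement_one_left]
    rw [← h]
    exact Subgroup.commutator_mem_commutator (hlH _) hdH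
  · by_cases hq : q = p
    · subst hq
      simp [hcp]
    · rw [hgp q hq, Units.val_one, sub_self]
      exact dvd_zero _

end ZHat

/-! ### The sign character modulo 2 -/

namespace ZHat

open Matrix.GeneralLinearGroup
open scoped commutatorElement

/-- The sign character of `GL₂(𝔽₂) ≃ S₃`, written additively: the polynomial takes the value `1`
exactly at the three involutions. -/
def parity : GL (Fin 2) (ZMod 2) →* Multiplicative (ZMod 2) :=
  MonoidHom.mk' (fun A => Multiplicative.ofAdd
    (A.val 0 0 * A.val 0 1 + A.val 0 1 * A.val 1 0 + A.val 1 0 * A.val 1 1)) fun A B => by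
    have key : ∀ a b c d a' b' c' d' : ZMod 2, a * d - b * c = 1 → a' * d' - b' * c' = 1 →
        (a * a' + b * c') * (a * b' + b * d') + (a * b' + b * d') * (c * a' + d * c') +
          (c * a' + d * c') * (c * b' + d * d') =
        (a * b + b * c + c * d) + (a' * b' + b' * c' + c' * d') := by decide
    have hdet (A : GL (Fin 2) (ZMod 2)) :
        A.val 0 0 * A.val 1 1 - A.val 0 1 * A.val 1 0 = 1 := by
      rw [← Matrix.det_fin_two, ← val_det_apply, Subsingleton.elim (det A) 1, Units.val_one]
    rw [← ofAdd_add, ← key _ _ _ _ _ _ _ _ (hdet A) (hdet B)]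
    simp only [Units.val_mul, Matrix.mul_apply, Fin.sum_univ_two]

/-- Reduction modulo `2`, through the component `ℤ₂` of `Ẑ`. -/
def modTwo : ZHat →+* ZMod 2 :=
  (PadicInt.toZMod (p := ((⟨2, Nat.prime_two⟩ : Nat.Primes) : ℕ))).comp
    (Pi.evalRingHom (fun q : Nat.Primes => ℤ_[(q : ℕ)]) ⟨2, Nat.prime_two⟩)

lemma gamma_two_le_ker_parity : gamma 2 ≤ (parity.comp (map modTwo)).ker := by
  intro g hg
  have h : map modTwo g = 1 := by
    ext i j
    obtain ⟨x, hx⟩ := mem_gamma_iff_dvd.1 hg i j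
    have h2 : modTwo (g.val i j) - modTwo ((1 : Matrix (Fin 2) (Fin 2) ZHat) i j) = 0 := by
      rw [← map_sub, hx, map_mul, map_natCast]
      exact zero_mul _
    rw [GeneralLinearGroup.map_apply, sub_eq_zero.1 h2]
    obtain rfl | hij := eq_or_ne i j
    · rw [Units.val_one, Matrix.one_apply_eq, Matrix.one_apply_eq, map_one]
    · rw [Units.val_one, Matrix.one_apply_ne hij, Matrix.one_apply_ne hij, map_zero]
  rw [MonoidHom.mem_ker, MonoidHom.comp_apply, h, map_one]

/-! ### The closed commutator subgroup of an open subgroup -/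

lemma topCommutator_mono {H K : Subgroup (GL (Fin 2) ZHat)} (h : H ≤ K) :
    topCommutator H ≤ topCommutator K :=
  closure_mono (Subgroup.commutator_mono h h)

lemma topCommutator_le_of_isClosed {H K : Subgroup (GL (Fin 2) ZHat)} (h : ⁅H, H⁆ ≤ K)
    (hK : IsClosed (K : Set (GL (Fin 2) ZHat))) : topCommutator H ≤ K :=
  Subgroup.topologicalClosure_minimal _ h hK

lemma commutator_le_topCommutator (H : Subgroup (GL (Fin 2) ZHat)) : ⁅H, H⁆ ≤ topCommutator H :=
  Subgroup.le_topologicalClosure _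

lemma commutator_le_ker {A : Type*} [CommGroup A] (H : Subgroup (GL (Fin 2) ZHat))
    (f : GL (Fin 2) ZHat →* A) : ⁅H, H⁆ ≤ f.ker :=
  (Subgroup.commutator_mono le_top le_top).trans (Abelianization.commutator_subset_ker f)

lemma topCommutator_le_ker_det (H : Subgroup (GL (Fin 2) ZHat)) :
    topCommutator H ≤ Matrix.GeneralLinearGroup.det.ker :=
  topCommutator_le_of_isClosed (commutator_le_ker H _)
    (isClosed_singleton.preimage GeneralLinearGroup.continuous_det)

lemma topCommutator_le_ker_parity (H : Subgroup (GL (Fin 2) ZHat)) :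
    topCommutator H ≤ (parity.comp (map modTwo)).ker :=
  topCommutator_le_of_isClosed (commutator_le_ker H _) <| Subgroup.isClosed_of_isOpen _ <|
    Subgroup.isOpen_mono gamma_two_le_ker_parity (isOpen_gamma two_pos)

section openSubgroup

variable {G : Subgroup (GL (Fin 2) ZHat)}

lemma exists_inf_gamma_le (hG : IsOpen (G : Set (GL (Fin 2) ZHat)))
    (T : Subgroup (GL (Fin 2) ZHat)) : ∃ n, 0 < n ∧ T ⊓ gamma n ≤ G := by
  obtain ⟨n, hn, h⟩ := exists_gamma_le hG
  exact ⟨n, hn, inf_le_right.trans h⟩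

lemma topCommutator_le (hG : IsOpen (G : Set (GL (Fin 2) ZHat))) : topCommutator G ≤ G :=
  topCommutator_le_of_isClosed (Subgroup.commutator_le_self G) (Subgroup.isClosed_of_isOpen _ hG)

lemma exists_inf_gamma_le_topCommutator (hG : IsOpen (G : Set (GL (Fin 2) ZHat))) :
    ∃ n, 0 < n ∧ Matrix.GeneralLinearGroup.det.ker ⊓ gamma n ≤ topCommutator G := by
  obtain ⟨n, hn, h⟩ := exists_gamma_le hG
  refine ⟨((2 * n) ^ 2) ^ 2, by positivity,
    (ker_det_inf_gamma_le_commutator (Nat.dvd_mul_right 2 n)).trans ?_⟩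
  have h2 : gamma (2 * n) ≤ G := (gamma_le_gamma (Nat.dvd_mul_left n 2)).trans h
  exact (Subgroup.commutator_mono h2 h2).trans (commutator_le_topCommutator G)

lemma isOpen_interSL_topCommutator (hG : IsOpen (G : Set (GL (Fin 2) ZHat))) :
    IsOpen (interSL (topCommutator G) : Set (SpecialLinearGroup (Fin 2) ZHat)) := by
  obtain ⟨n, hn, h⟩ := exists_inf_gamma_le_topCommutator hG
  refine Subgroup.isOpen_mono (ker_map_red_le_iff.2 h) ?_
  convert (isOpen_gamma hn).preimage SpecialLinearGroup.continuous_toGL using 1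
  ext A
  exact mem_ker_map_red_iff

/-- The primes dividing `N` are the primes dividing the level of `[G, G]`. -/
lemma dvd_commutatorRadical_iff (hG : IsOpen (G : Set (GL (Fin 2) ZHat))) (p : Nat.Primes) :
    (p : ℕ) ∣ commutatorRadical G ↔
      (p : ℕ) ∣ levelOn Matrix.GeneralLinearGroup.det.ker (topCommutator G) := by
  have hpos := (levelOn_mem (exists_inf_gamma_le_topCommutator hG)).1
  rw [commutatorRadical, levelSL_interSL_eq, p.2.prime.dvd_finsetProd_iff]
  constructor
  · rintro ⟨q, hq, hpq⟩
    exact hpq.trans (Nat.dvd_of_mem_primeFactors hq)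
  · exact fun h => ⟨p, Nat.mem_primeFactors.2 ⟨p.2, h, hpos.ne'⟩, dvd_rfl⟩

/-- The level of `[G, G]` is even: the commutator subgroup of `GL₂(𝔽₂)` does not contain the
transvections. -/
lemma two_dvd_commutatorRadical (hG : IsOpen (G : Set (GL (Fin 2) ZHat))) :
    2 ∣ commutatorRadical G := by
  classical
  let two : Nat.Primes := ⟨2, Nat.prime_two⟩
  refine (dvd_commutatorRadical_iff hG two).2 (by_contra fun h => ?_)
  have hmem := (not_dvd_levelOn_iff restrict_mem_ker_det (exists_inf_gamma_le_topCommutator hG)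
    two).1 h (upperRightHom (Pi.single two 1)) (det_upperRightHom _) fun q hq => by
      rw [glEquiv_upperRightHom, Pi.single_eq_of_ne hq, AddChar.map_zero_eq_one]
  have hpar := topCommutator_le_ker_parity G hmem
  have h0 : (Pi.single two 1 : ZHat) two = 1 := Pi.single_eq_same _ _
  have h1 : modTwo (Pi.single two 1) = 1 :=
    (congrArg (PadicInt.toZMod (p := (two : ℕ))) h0).trans (map_one _)
  have h2 : map modTwo (upperRightHom (Pi.single two 1)) = upperRightHom 1 := by
    ext i j
    fin_cases i <;> fin_cases j <;> simp [h1]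
  rw [MonoidHom.mem_ker, MonoidHom.comp_apply, h2] at hpar
  have h3 : parity (upperRightHom 1) = Multiplicative.ofAdd 1 := by
    simp [parity]
  rw [h3] at hpar
  exact absurd hpar (by decide)

/-- The factors of `SL₂(Ẑ)` at the primes not dividing `N` lie in `[G, G]`. -/
lemma mem_topCommutator_of_forall_dvd (hG : IsOpen (G : Set (GL (Fin 2) ZHat)))
    {g : GL (Fin 2) ZHat} (hdet : g ∈ Matrix.GeneralLinearGroup.det.ker)
    (hg : ∀ p : Nat.Primes, (p : ℕ) ∣ commutatorRadical G → glEquiv g p = 1) :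
    g ∈ topCommutator G :=
  mem_of_forall_dvd_levelOn (exists_inf_gamma_le_topCommutator hG) hdet fun p hp =>
    hg p ((dvd_commutatorRadical_iff hG p).2 hp)

end openSubgroup

/-! ### The agreeable closure -/

lemma map_proj_eq_iff {N : ℕ} {g h : GL (Fin 2) ZHat} :
    map (ZHat.proj N) g = map (ZHat.proj N) h ↔
      ∀ p : Nat.Primes, (p : ℕ) ∣ N → glEquiv g p = glEquiv h p := by
  constructor
  · refine fun H p hp => Units.ext (Matrix.ext fun i j => ?_)
    have h := congrFun (congrFun (congrFun (congrArg (fun x => x.val) H) i) j) ⟨p, hp⟩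
    exact h
  · refine fun H => Units.ext (Matrix.ext fun i j => funext fun p => ?_)
    change g.val i j p.1 = h.val i j p.1
    rw [← glEquiv_apply, H p.1 p.2, glEquiv_apply]

lemma scalarSubgroup_eq_center (R : Type) [CommRing R] :
    scalarSubgroup R = Subgroup.center (GL (Fin 2) R) :=
  center_eq_range_scalar.symm

lemma map_scalarSubgroup_of_surjective {R S : Type} [CommRing R] [CommRing S] (f : R →+* S)
    (hf : ∀ s : Sˣ, ∃ t : Rˣ, f t = s) :
    (scalarSubgroup R).map (map f) = scalarSubgroup S := by
  refine le_antisymm ?_ ?_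
  · rintro _ ⟨_, ⟨s, rfl⟩, rfl⟩
    exact ⟨Units.map (f : R →* S) s, (map_scalar (n := Fin 2) f s).symm⟩
  · rintro _ ⟨s, rfl⟩
    obtain ⟨t, ht⟩ := hf s
    refine ⟨_, ⟨t, rfl⟩, (map_scalar (n := Fin 2) f t).trans ?_⟩
    exact congrArg _ (Units.ext ht)

lemma map_map_proj_scalarSubgroup (N : ℕ) :
    (scalarSubgroup ZHat).map (map (ZHat.proj N)) = scalarSubgroup (ZAdic N) := by
  classical
  refine map_scalarSubgroup_of_surjective _ fun s => ?_
  refine ⟨MulEquiv.piUnits.symm fun p =>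
    if h : (p : ℕ) ∣ N then MulEquiv.piUnits s ⟨p, h⟩ else 1, funext fun p => ?_⟩
  exact congrArg Units.val (dif_pos p.2)

/-- The elements of the agreeable closure are those that agree with an element of `Ẑˣ · G` at the
primes dividing `N`. -/
lemma mem_agreeableClosure_iff {G : Subgroup (GL (Fin 2) ZHat)} {h : GL (Fin 2) ZHat} :
    h ∈ agreeableClosure G ↔ ∃ s ∈ Subgroup.center (GL (Fin 2) ZHat), ∃ g ∈ G,
      ∀ p : Nat.Primes, (p : ℕ) ∣ commutatorRadical G → glEquiv h p = glEquiv (s * g) p := by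
  have hn : (scalarSubgroup ZHat).Normal := by
    rw [scalarSubgroup_eq_center]
    infer_instance
  rw [agreeableClosure, imageAdic, ← map_map_proj_scalarSubgroup, ← Subgroup.map_sup,
    ← scalarSubgroup_eq_center, Subgroup.mem_comap, Subgroup.mem_map]
  simp only [Subgroup.mem_sup_of_normal_left, ← map_proj_eq_iff]
  constructor
  · rintro ⟨_, ⟨s, hs, g, hg, rfl⟩, h⟩
    exact ⟨s, hs, g, hg, h.symm⟩
  · rintro ⟨s, hs, g, hg, h⟩
    exact ⟨_, ⟨s, hs, g, hg, rfl⟩, h.symm⟩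

lemma commutatorElement_center_mul {K : Type*} [Group K] {s t : K} (hs : s ∈ Subgroup.center K)
    (ht : t ∈ Subgroup.center K) (g h : K) : ⁅s * g, t * h⁆ = ⁅g, h⁆ := by
  have left {s : K} (hs : s ∈ Subgroup.center K) (g h : K) : ⁅s * g, h⁆ = ⁅g, h⁆ := by
    rw [commutatorElement_def, commutatorElement_def, mul_assoc s g h, mul_assoc s,
      ← Subgroup.mem_center_iff.1 hs]
    group
  rw [left hs, ← commutatorElement_inv, left ht, commutatorElement_inv]

section agreeable

variable {G : Subgroup (GL (Fin 2) ZHat)}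

lemma le_agreeableClosure : G ≤ agreeableClosure G := fun g hg =>
  mem_agreeableClosure_iff.2 ⟨1, one_mem _, g, hg, fun p _ => by rw [one_mul]⟩

/-- A commutator in the agreeable closure agrees at the primes dividing `N` with a commutator in `G`,
because scalars are central. The two differ by an element of `SL₂(Ẑ)` supported away from `N`, which
lies in `[G, G]`. -/
lemma commutator_agreeableClosure_le (hG : IsOpen (G : Set (GL (Fin 2) ZHat))) :
    ⁅agreeableClosure G, agreeableClosure G⁆ ≤ topCommutator G := by
  refine Subgroup.commutator_le.2 fun h₁ hh₁ h₂ hh₂ => ?_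
  obtain ⟨s₁, hs₁, g₁, hg₁, e₁⟩ := mem_agreeableClosure_iff.1 hh₁
  obtain ⟨s₂, hs₂, g₂, hg₂, e₂⟩ := mem_agreeableClosure_iff.1 hh₂
  have hg : ⁅g₁, g₂⁆ ∈ topCommutator G :=
    commutator_le_topCommutator G (Subgroup.commutator_mem_commutator hg₁ hg₂)
  rw [← mul_mem_cancel_right (inv_mem hg)]
  refine mem_topCommutator_of_forall_dvd hG ?_ fun p hp => ?_
  · refine mul_mem ?_ (inv_mem (topCommutator_le_ker_det G hg))
    rw [MonoidHom.mem_ker, map_commutatorElement, commutatorElement_eq_one_iff_mul_comm, mul_comm]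
  · rw [map_mul, map_inv, Pi.mul_apply, Pi.inv_apply, mul_inv_eq_one, glEquiv_commutatorElement,
      e₁ p hp, e₂ p hp, ← glEquiv_commutatorElement, commutatorElement_center_mul hs₁ hs₂]

lemma topCommutator_agreeableClosure (hG : IsOpen (G : Set (GL (Fin 2) ZHat))) :
    topCommutator (agreeableClosure G) = topCommutator G :=
  le_antisymm (topCommutator_le_of_isClosed (commutator_agreeableClosure_le hG)
    (Subgroup.isClosed_topologicalClosure _)) (topCommutator_mono le_agreeableClosure)

lemma isOpen_agreeableClosure (hG : IsOpen (G : Set (GL (Fin 2) ZHat))) :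
    IsOpen (agreeableClosure G : Set (GL (Fin 2) ZHat)) :=
  Subgroup.isOpen_mono le_agreeableClosure hG

lemma map_det_agreeableClosure (hdet : G.map Matrix.GeneralLinearGroup.det = ⊤) :
    (agreeableClosure G).map Matrix.GeneralLinearGroup.det = ⊤ :=
  top_le_iff.1 (hdet ▸ Subgroup.map_mono le_agreeableClosure)

lemma isAgreeable_agreeableClosure (hG : IsOpen (G : Set (GL (Fin 2) ZHat)))
    (hdet : G.map Matrix.GeneralLinearGroup.det = ⊤) : IsAgreeable (agreeableClosure G) where
  isOpen := isOpen_agreeableClosure hG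
  map_det := map_det_agreeableClosure hdet
  scalar_le s hs := mem_agreeableClosure_iff.2
    ⟨s, scalarSubgroup_eq_center ZHat ▸ hs, 1, one_mem _, fun p _ => by rw [mul_one]⟩
  level_iff p hp hp2 := by
    obtain ⟨p, rfl⟩ : ∃ q : Nat.Primes, (q : ℕ) = p := ⟨⟨p, hp⟩, rfl⟩
    have hopen := isOpen_agreeableClosure hG
    rw [levelGL_eq, levelSL_interSL_eq]
    refine not_iff_not.1 ?_
    rw [not_dvd_levelOn_iff (fun _ _ _ => Subgroup.mem_top _) (exists_inf_gamma_le hopen _) p,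
      not_dvd_levelOn_iff restrict_mem_ker_det (exists_inf_gamma_le hopen _) p]
    refine ⟨fun h g _ => h g trivial, fun h g _ hg => ?_⟩
    -- as `SL₂(ℤ_p)` lies in the agreeable closure, it lies in `[G, G]`, so `p` does not divide `N`
    have hpN : ¬ (p : ℕ) ∣ commutatorRadical G := by
      rw [dvd_commutatorRadical_iff hG p, not_dvd_levelOn_iff restrict_mem_ker_det
        (exists_inf_gamma_le_topCommutator hG)]
      exact fun k hk hkp => commutator_agreeableClosure_le hG
        (mem_commutator_of_forall_mem (map_det_agreeableClosure hdet) hp2 h hk hkp)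
    refine mem_agreeableClosure_iff.2 ⟨1, one_mem _, 1, one_mem _, fun q hq => ?_⟩
    rw [hg q fun e => hpN (e ▸ hq), mul_one, map_one, Pi.one_apply]

/-- For a prime `ℓ ∤ N`, an agreeable group `H` that contains `G` contains `SL₂(ℤ_ℓ)`, because
`[G, G]` does; as `ℓ` is odd, `H` contains `GL₂(ℤ_ℓ)`. -/
lemma agreeableClosure_le (hG : IsOpen (G : Set (GL (Fin 2) ZHat)))
    {H : Subgroup (GL (Fin 2) ZHat)} (hH : IsAgreeable H) (hGH : G ≤ H) :
    agreeableClosure G ≤ H := by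
  have hlevel (p : Nat.Primes) (hp : (p : ℕ) ∣ levelOn ⊤ H) : (p : ℕ) ∣ commutatorRadical G := by
    by_cases hp2 : (p : ℕ) = 2
    · exact hp2 ▸ two_dvd_commutatorRadical hG
    · rw [← levelGL_eq, hH.level_iff p p.2 hp2, levelSL_interSL_eq] at hp
      by_contra hpN
      refine (not_dvd_levelOn_iff restrict_mem_ker_det (exists_inf_gamma_le hH.isOpen _) p).2
        (fun g hg hgp => hGH (topCommutator_le hG
          (mem_topCommutator_of_forall_dvd hG hg fun q hq => hgp q fun e => hpN (e ▸ hq)))) hp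
  intro h hh
  obtain ⟨s, hs, g, hg, e⟩ := mem_agreeableClosure_iff.1 hh
  rw [← scalarSubgroup_eq_center] at hs
  have hsg : s * g ∈ H := mul_mem (hH.scalar_le hs) (hGH hg)
  rw [← mul_mem_cancel_right (inv_mem hsg)]
  refine mem_of_forall_dvd_levelOn (exists_inf_gamma_le hH.isOpen ⊤) (Subgroup.mem_top _)
    fun p hp => ?_
  rw [map_mul, map_inv, Pi.mul_apply, Pi.inv_apply, mul_inv_eq_one]
  exact e p (hlevel p hp)

lemma isLeast_agreeableClosure (hG : IsOpen (G : Set (GL (Fin 2) ZHat)))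
    (hdet : G.map Matrix.GeneralLinearGroup.det = ⊤) :
    IsLeast {H : Subgroup (GL (Fin 2) ZHat) | IsAgreeable H ∧ G ≤ H} (agreeableClosure G) :=
  ⟨⟨isAgreeable_agreeableClosure hG hdet, le_agreeableClosure⟩,
    fun _ hH => agreeableClosure_le hG hH.1 hH.2⟩

lemma commutatorElement_mem_of_mem_agreeableClosure (hG : IsOpen (G : Set (GL (Fin 2) ZHat)))
    {x y : GL (Fin 2) ZHat} (hx : x ∈ agreeableClosure G) (hy : y ∈ agreeableClosure G) :
    ⁅x, y⁆ ∈ G :=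
  topCommutator_le hG
    (commutator_agreeableClosure_le hG (Subgroup.commutator_mem_commutator hx hy))

lemma finiteIndex_of_isOpen (hG : IsOpen (G : Set (GL (Fin 2) ZHat))) : G.FiniteIndex := by
  have : CompactSpace (Matrix (Fin 2) (Fin 2) ZHat) :=
    inferInstanceAs (CompactSpace (Fin 2 → Fin 2 → ZHat))
  have : Finite (GL (Fin 2) ZHat ⧸ G) := Subgroup.quotient_finite_of_isOpen G hG
  exact Subgroup.finiteIndex_of_finite_quotient

end agreeable

end ZHat

end

theorem proposition7p1 (G : Subgroup (GL (Fin 2) ZHat))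
    (hG : IsOpen (G : Set (GL (Fin 2) ZHat)))
    (hdet : G.map Matrix.GeneralLinearGroup.det = ⊤) :
    -- `[G, G]` is an open subgroup of `SL₂(Ẑ)`, so that its level makes sense
    (topCommutator G ≤ (Matrix.SpecialLinearGroup.toGL (n := Fin 2) (R := ZHat)).range ∧
      IsOpen (interSL (topCommutator G) : Set (Matrix.SpecialLinearGroup (Fin 2) ZHat))) ∧
    -- there is a unique minimal agreeable subgroup that contains `G`
    (∃! H : Subgroup (GL (Fin 2) ZHat), Minimal (fun H => IsAgreeable H ∧ G ≤ H) H) ∧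
    -- it is the explicit group, which lies in every agreeable subgroup that contains `G`
    IsLeast {H : Subgroup (GL (Fin 2) ZHat) | IsAgreeable H ∧ G ≤ H} (agreeableClosure G) ∧
    topCommutator G = topCommutator (agreeableClosure G) ∧
    -- `G` is normal in its agreeable closure, with finite abelian quotient
    ∃ _ : (G.subgroupOf (agreeableClosure G)).Normal,
      Finite (agreeableClosure G ⧸ G.subgroupOf (agreeableClosure G)) ∧
      ∀ x y : agreeableClosure G ⧸ G.subgroupOf (agreeableClosure G), x * y = y * x := by
  have hleast := ZHat.isLeast_agreeableClosure hG hdet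
  refine ⟨⟨fun g hg => ZHat.exists_toGL_eq (ZHat.topCommutator_le_ker_det G hg),
    ZHat.isOpen_interSL_topCommutator hG⟩,
    ⟨agreeableClosure G, hleast.minimal, fun H hH => hleast.minimal_iff.1 hH⟩, hleast,
    (ZHat.topCommutator_agreeableClosure hG).symm, ⟨fun n hn g => ?_⟩, ?_, fun x y => ?_⟩
  · have h := mul_mem (ZHat.commutatorElement_mem_of_mem_agreeableClosure hG g.2 n.2)
      (Subgroup.mem_subgroupOf.1 hn)
    rw [commutatorElement_def, inv_mul_cancel_right] at h
    exact h
  · have := ZHat.finiteIndex_of_isOpen hG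
    exact Subgroup.finite_quotient_of_finiteIndex
  · induction x using QuotientGroup.induction_on with | _ x
    induction y using QuotientGroup.induction_on with | _ y
    refine QuotientGroup.eq.2 (Subgroup.mem_subgroupOf.2 ?_)
    have h := ZHat.commutatorElement_mem_of_mem_agreeableClosure hG (inv_mem y.2) (inv_mem x.2)
    rw [commutatorElement_def, inv_inv, inv_inv] at h
    simpa [mul_assoc] using h
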